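/- **Conventions.** A logic is a finitary, substitution-invariant consequence relation $\vdash$ on the set $Fm$ of formulas of an algebraic language over variables $\{x_n : n\in\omega\}$; $\vdash'$ is an extension of $\vdash$ (in the same language) if $\Gamma\vdash\varphi$ implies $\Gamma\vdash'\varphi$. A rule $\Gamma\rhd\varphi$ ($\Gamma$ finite) is *derivable* in $\vdash$ if $\Gamma\vdash\varphi$, and *passive* in $\vdash$ if there is no substitution $\sigma$ with $\emptyset\vdash\sigma(\gamma)$ for all $\gamma\in\Gamma$. A logic is *passively structurally complete* (PSC) if every rule that is passive in it is derivable in it. A *quasivariety* is a class of similar algebras axiomatized by quasiequations. It has the *joint embedding property* (JEP) if any two of its nontrivial members embed into a common member. A logic $\vdash$ is *algebraized* by a quasivariety $\mathsf K$ if there are a finite set of equations $\tau(x)$ and a finite set of formulas $\Delta(x,y)$ such that, for all $\Gamma\cup\{\varphi\}\subseteq Fm$, $$\Gamma\vdash\varphi\iff\bigcup_{\gamma\in\Gamma}\tau(\gamma)\vDash_{\mathsf K}\tau(\varphi),$$ and $x\approx y$ and $\bigcup_{\delta\in\Delta(x,y)}\tau(\delta)$ follow from each other under $\vDash_{\mathsf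 K}$, where $\vDash_{\mathsf K}$ is equational consequence relative to $\mathsf K$. Let $[0,1]_G=\langle[0,1];\wedge,\vee,\cdot,\to,0,1\rangle$ be the standard Gödel algebra: $\wedge$ and $\cdot$ are both $\min$, $\vee$ is $\max$, and $a\to c=1$ if $a\le c$, $a\to c=c$ otherwise. Gödel algebras are the members of the variety generated by $[0,1]_G$. A *rational Gödel algebra* is an algebra in this language expanded with constants $\boldsymbol c_q$ ($q\in[0,1]\cap\mathbb Q$) whose constant-free reduct is a Gödel algebra and which validates, for all $p,q\in[0,1]\cap\mathbb Q$, the equations $$\boldsymbol c_p\cdot\boldsymbol c_q\approx\boldsymbol c_{\min(p,q)},\qquad \boldsymbol c_p\to\boldsymbol c_q\approx\boldsymbol c_{p\to q},\qquad \boldsymbol c_0\approx 0,\qquad \boldsymbol c_1\approx 1,$$ where $p\to q$ is computed in $[0,1]_G$. Let $\mathsf{RGA}$ be the class of these algebras. *Rational Gödel logic* $\mathbf{RG}$ is the logic in this language with $\Gamma\vdash\varphi$ iff there is a finite $\Delta\subseteq\Gamma$ such that $\{\delta\approx1:\delta\in\Delta\}\vDash_{\mathsf{RGA}}\varphi\approx1$.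 **Theorem 8.1.** For every extension $\vdash$ of $\mathbf{RG}$ the following conditions are equivalent: 1. $\vdash$ is PSC; 2. $\vdash$ is algebraized by a quasivariety with the JEP; 3. $\vdash$ is algebraized by a quasivariety any two nontrivial members of which have isomorphic zero-generated subalgebras. -/

import Mathlib

open scoped FirstOrder
open CategoryTheory (Bundled)

universe u

namespace RationalGodel

/-! ### Equations, quasivarieties and equational consequence

Algebras of an algebraic language `L` are `L`-structures (all languages used below have no
relation symbols and have constant symbols, so algebras are automatically nonempty). -/

/-- Equations `ε ≈ δ` between terms with variables in `α`. -/
abbrev Eqn (L : FirstOrder.Language.{0, 0}) (α : Type) : Type := L.Term α × L.Term α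

/-- Formulas: terms in the denumerable set of variables `{x_n : n ∈ ω}`. -/
abbrev Fm (L : FirstOrder.Language.{0, 0}) : Type := L.Term ℕ

/-- Classes of algebras of the language `L` (with universes in `Type u`). -/
abbrev AlgClass (L : FirstOrder.Language.{0, 0}) : Type (u + 1) := Set (Bundled.{u} L.Structure)

/-- The assignment `v` satisfies the equation `e` in `A`. -/
def Eqn.Holds {L : FirstOrder.Language.{0, 0}} {α : Type} {A : Type u} [L.Structure A]
    (e : Eqn L α) (v : α → A) : Prop :=
  e.1.realize v = e.2.realize v

/-- Quasiequations; the antecedent may be empty. -/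
structure QuasiEqn (L : FirstOrder.Language.{0, 0}) where
  premises : List (Eqn L ℕ)
  conclusion : Eqn L ℕ

/-- Validity of a quasiequation in an algebra. -/
def QuasiEqn.Valid {L : FirstOrder.Language.{0, 0}} (q : QuasiEqn L) (A : Type u) [L.Structure A] : Prop :=
  ∀ v : ℕ → A, (∀ e ∈ q.premises, e.Holds v) → q.conclusion.Holds v

/-- A quasivariety is a class of algebras axiomatized by quasiequations. -/
def IsQuasivariety {L : FirstOrder.Language.{0, 0}} (K : AlgClass.{u} L) : Prop :=
  ∃ Q : Set (QuasiEqn L), ∀ A : Bundled.{u} L.Structure, A ∈ K ↔ ∀ q ∈ Q, q.Valid A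

/-- Members, in `Type u`, of the variety generated by the algebra `B`: the algebras validating
all equations valid in `B`. -/
def varietyGeneratedBy {L : FirstOrder.Language.{0, 0}} (B : Type) [L.Structure B] : AlgClass.{u} L :=
  {A | ∀ e : Eqn L ℕ, (∀ v : ℕ → B, e.Holds v) → ∀ v : ℕ → A, e.Holds v}

/-- Equational consequence relative to the class `K`. -/
def EqConsequence {L : FirstOrder.Language.{0, 0}} (K : AlgClass.{u} L) (Θ : Set (Eqn L ℕ))
    (e : Eqn L ℕ) : Prop :=
  ∀ A ∈ K, ∀ v : ℕ → A, (∀ e' ∈ Θ, e'.Holds v) → e.Holds v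

/-- The joint embedding property: any two nontrivial members embed into a common member. -/
def HasJEP {L : FirstOrder.Language.{0, 0}} (K : AlgClass.{u} L) : Prop :=
  ∀ A ∈ K, ∀ B ∈ K, Nontrivial A → Nontrivial B →
    ∃ C ∈ K, Nonempty (A ↪[L] C) ∧ Nonempty (B ↪[L] C)

/-- The zero-generated subalgebra of `A`. -/
def zeroGenerated (L : FirstOrder.Language.{0, 0}) (A : Type u) [L.Structure A] : L.Substructure A :=
  FirstOrder.Language.Substructure.closure L ∅

/-- All nontrivial members of `K` have isomorphic zero-generated subalgebras. -/
def HasIsoZeroGenerated {L : FirstOrder.Language.{0, 0}} (K : AlgClass.{u} L) : Prop :=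
  ∀ A ∈ K, ∀ B ∈ K, Nontrivial A → Nontrivial B →
    Nonempty (zeroGenerated L A ≃[L] zeroGenerated L B)

/-! ### Logics -/

/-- A (finitary, substitution invariant) propositional logic in the language `L`. -/
structure PropLogic (L : FirstOrder.Language.{0, 0}) where
  Entails : Set (Fm L) → Fm L → Prop
  of_mem : ∀ {Γ : Set (Fm L)} {φ : Fm L}, φ ∈ Γ → Entails Γ φ
  cut : ∀ {Γ Δ : Set (Fm L)} {φ : Fm L}, (∀ ψ ∈ Δ, Entails Γ ψ) → Entails Δ φ → Entails Γ φ
  subst : ∀ {Γ : Set (Fm L)} {φ : Fm L} (σ : ℕ → Fm L), Entails Γ φ →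
    Entails ((fun γ : Fm L => γ.subst σ) '' Γ) (φ.subst σ)
  finitary : ∀ {Γ : Set (Fm L)} {φ : Fm L}, Entails Γ φ →
    ∃ Δ : Set (Fm L), Δ ⊆ Γ ∧ Δ.Finite ∧ Entails Δ φ

/-- `l'` is an extension of `l`. -/
def PropLogic.IsExtension {L : FirstOrder.Language.{0, 0}} (l' l : PropLogic L) : Prop :=
  ∀ (Γ : Set (Fm L)) (φ : Fm L), l.Entails Γ φ → l'.Entails Γ φ

/-- A rule `Γ ▷ φ` with finite `Γ`. -/
structure InfRule (L : FirstOrder.Language.{0, 0}) where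
  premises : Finset (Fm L)
  conclusion : Fm L

/-- A rule is derivable if its premises entail its conclusion. -/
def PropLogic.Derivable {L : FirstOrder.Language.{0, 0}} (l : PropLogic L) (r : InfRule L) : Prop :=
  l.Entails (↑r.premises) r.conclusion

/-- A rule is active if some substitution turns all its premises into theorems. -/
def PropLogic.Active {L : FirstOrder.Language.{0, 0}} (l : PropLogic L) (r : InfRule L) : Prop :=
  ∃ σ : ℕ → Fm L, ∀ γ ∈ r.premises, l.Entails ∅ (γ.subst σ)

/-- A rule is passive if it is not active. -/
def PropLogic.Passive {L : FirstOrder.Language.{0, 0}} (l : PropLogic L) (r : InfRule L) : Prop :=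
  ¬ l.Active r

/-- Passive structural completeness: all passive rules are derivable. -/
def PropLogic.IsPSC {L : FirstOrder.Language.{0, 0}} (l : PropLogic L) : Prop :=
  ∀ r : InfRule L, l.Passive r → l.Derivable r

/-- For a set of equations `τ(x)`, the set of equations `τ(φ)`. -/
def instEqns {L : FirstOrder.Language.{0, 0}} (τ : Finset (Eqn L (Fin 1))) (φ : Fm L) : Set (Eqn L ℕ) :=
  {e | ∃ e' ∈ τ, e = (e'.1.subst fun _ => φ, e'.2.subst fun _ => φ)}

/-- The set of equations `⋃ {τ(γ) : γ ∈ Γ}`. -/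
def transl {L : FirstOrder.Language.{0, 0}} (τ : Finset (Eqn L (Fin 1))) (Γ : Set (Fm L)) :
    Set (Eqn L ℕ) :=
  ⋃ γ ∈ Γ, instEqns τ γ

/-- For a set of formulas `Δ(x, y)`, the set of formulas `Δ(φ, ψ)`. -/
def instFms {L : FirstOrder.Language.{0, 0}} (Δ : Finset (L.Term (Fin 2))) (φ ψ : Fm L) : Set (Fm L) :=
  {χ | ∃ δ ∈ Δ, χ = δ.subst ![φ, ψ]}

/-- The logic `l` is algebraized by the quasivariety `K`: the equivalence is witnessed by a
finite set of equations `τ(x)` and a finite set of formulas `Δ(x, y)`. -/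
def PropLogic.AlgebraizedBy {L : FirstOrder.Language.{0, 0}} (l : PropLogic L) (K : AlgClass.{u} L) :
    Prop :=
  IsQuasivariety K ∧
  ∃ (τ : Finset (Eqn L (Fin 1))) (Δ : Finset (L.Term (Fin 2))),
    (∀ (Γ : Set (Fm L)) (φ : Fm L),
      l.Entails Γ φ ↔ ∀ e ∈ instEqns τ φ, EqConsequence K (transl τ Γ) e) ∧
    (∀ e ∈ transl τ (instFms Δ (FirstOrder.Language.Term.var 0) (FirstOrder.Language.Term.var 1)),
      EqConsequence K {(FirstOrder.Language.Term.var 0, FirstOrder.Language.Term.var 1)} e) ∧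
    EqConsequence K (transl τ (instFms Δ (FirstOrder.Language.Term.var 0) (FirstOrder.Language.Term.var 1)))
      (FirstOrder.Language.Term.var 0, FirstOrder.Language.Term.var 1)

theorem transl_mono {L : FirstOrder.Language.{0, 0}} (τ : Finset (Eqn L (Fin 1))) {Γ Γ' : Set (Fm L)}
    (h : Γ ⊆ Γ') : transl τ Γ ⊆ transl τ Γ' :=
  Set.biUnion_subset_biUnion_left h

/-- The logic in which `Γ` entails `φ` when `τ[Δ] ⊨_K τ(φ)` for some finite `Δ ⊆ Γ`. -/
def logicOf {L : FirstOrder.Language.{0, 0}} (K : AlgClass.{0} L) (τ : Finset (Eqn L (Fin 1))) :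
    PropLogic L where
  Entails Γ φ := ∃ Δ : Set (Fm L), Δ ⊆ Γ ∧ Δ.Finite ∧
    ∀ e ∈ instEqns τ φ, EqConsequence K (transl τ Δ) e
  of_mem {Γ φ} h := ⟨{φ}, by simpa using h, Set.finite_singleton φ,
    fun e he A _ v hv => hv e (Set.mem_biUnion rfl he)⟩
  cut {Γ Δ φ} h := by
    rintro ⟨Δ', hΔ', hfin, hφ⟩
    choose! F hF using h
    refine ⟨⋃ ψ ∈ Δ', F ψ, Set.iUnion₂_subset fun ψ hψ => (hF ψ (hΔ' hψ)).1,
      hfin.biUnion fun ψ hψ => (hF ψ (hΔ' hψ)).2.1, ?_⟩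
    intro e he A hA v hv
    refine hφ e he A hA v fun e' he' => ?_
    obtain ⟨ψ, hψ, he'⟩ := Set.mem_iUnion₂.1 he'
    exact (hF ψ (hΔ' hψ)).2.2 e' he' A hA v fun e'' he'' =>
      hv e'' (transl_mono τ (Set.subset_biUnion_of_mem (u := F) hψ) he'')
  subst {Γ φ} σ := by
    rintro ⟨Δ, hΔ, hfin, hφ⟩
    refine ⟨_, Set.image_mono hΔ, hfin.image _, ?_⟩
    rintro _ ⟨e, he, rfl⟩ A hA v hv
    have key := hφ _ ⟨e, he, rfl⟩ A hA (fun n => (σ n).realize v) ?_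
    · simpa [Eqn.Holds, FirstOrder.Language.Term.realize_subst] using key
    · intro e' he'
      obtain ⟨ψ, hψ, e'', he'', rfl⟩ := Set.mem_iUnion₂.1 he'
      have := hv _ (Set.mem_biUnion (Set.mem_image_of_mem _ hψ) ⟨e'', he'', rfl⟩)
      simpa [Eqn.Holds, FirstOrder.Language.Term.realize_subst] using this
  finitary := by
    rintro Γ φ ⟨Δ, hΔ, hfin, hφ⟩
    exact ⟨Δ, hΔ, hfin, Δ, subset_rfl, hfin, hφ⟩

/-! ### Gödel algebras and rational Gödel logic -/

/-- The operation symbols `∧, ∨, ·, →, 0, 1` of BL-algebras. -/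
inductive BLFunc : ℕ → Type
  | inf : BLFunc 2
  | sup : BLFunc 2
  | mul : BLFunc 2
  | imp : BLFunc 2
  | zero : BLFunc 0
  | one : BLFunc 0

/-- The language of BL-algebras. -/
def BLLang : FirstOrder.Language.{0, 0} := ⟨BLFunc, fun _ => Empty⟩

/-- The residuum of the minimum on a chain with top element `1`. -/
def godelImp {α : Type} [LinearOrder α] [One α] (a c : α) : α := if a ≤ c then 1 else c

/-- The Gödel chain on a linear order with least element `0` and greatest element `1`: the
product is the minimum. -/
@[reducible]
def godelStructure (α : Type) [LinearOrder α] [Zero α] [One α] : BLLang.Structure α where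
  funMap {n} f := match n, f with
    | _, BLFunc.inf => fun x => x 0 ⊓ x 1
    | _, BLFunc.sup => fun x => x 0 ⊔ x 1
    | _, BLFunc.mul => fun x => x 0 ⊓ x 1
    | _, BLFunc.imp => fun x => godelImp (x 0) (x 1)
    | _, BLFunc.zero => fun _ => 0
    | _, BLFunc.one => fun _ => 1
  RelMap r := r.elim

/-- The standard Gödel algebra on the real unit interval. -/
noncomputable instance standardGodel : BLLang.Structure unitInterval :=
  godelStructure unitInterval

/-- `godelImp` on `[0, 1]` is the residuum `⋁ {b : b ∗ a ≤ c}` of the minimum t-norm. -/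
theorem godelImp_isLUB (a c : unitInterval) : IsLUB {b | b ⊓ a ≤ c} (godelImp a c) := by
  unfold godelImp
  split_ifs with h
  · exact ⟨fun b _ => unitInterval.le_one', fun u hu => hu (inf_le_right.trans h)⟩
  · exact ⟨fun b hb => (inf_le_iff.1 hb).resolve_right h, fun u hu => hu (min_le_left c a)⟩

/-- The variety of Gödel algebras, generated by the standard Gödel algebra. -/
def GA : AlgClass.{u} BLLang := varietyGeneratedBy unitInterval

/-- The rationals in `[0, 1]`. -/
abbrev RatUnit : Type := Set.Icc (0 : ℚ) 1

/-- The language of BL-algebras expanded with the constants `c_q`, `q ∈ [0, 1] ∩ ℚ`. -/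
abbrev RGLang : FirstOrder.Language.{0, 0} := BLLang[[RatUnit]]

/-- The BL-reduct of an algebra in the expanded language. -/
def blReduct (A : Bundled.{u} RGLang.Structure) : Bundled.{u} BLLang.Structure :=
  ⟨A, (BLLang.lhomWithConstants RatUnit).reduct A⟩

/-- The term `c_q`. -/
def cst {α : Type} (q : RatUnit) : RGLang.Term α := (BLLang.con q).term

/-- The term `0`. -/
def zeroTm {α : Type} : RGLang.Term α :=
  FirstOrder.Language.Term.func (l := 0) (Sum.inl BLFunc.zero) ![]

/-- The term `1`. -/
def oneTm {α : Type} : RGLang.Term α :=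
  FirstOrder.Language.Term.func (l := 0) (Sum.inl BLFunc.one) ![]

/-- The term `s · t`. -/
def mulTm {α : Type} (s t : RGLang.Term α) : RGLang.Term α :=
  FirstOrder.Language.Term.func (l := 2) (Sum.inl BLFunc.mul) ![s, t]

/-- The term `s → t`. -/
def impTm {α : Type} (s t : RGLang.Term α) : RGLang.Term α :=
  FirstOrder.Language.Term.func (l := 2) (Sum.inl BLFunc.imp) ![s, t]

/-- The bookkeeping axioms of the standard Gödel algebra. -/
def bookkeeping : Set (Eqn RGLang ℕ) :=
  {e | (∃ p q : RatUnit, e = (mulTm (cst p) (cst q), cst (p ⊓ q))) ∨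
    (∃ p q : RatUnit, e = (impTm (cst p) (cst q), cst (godelImp p q))) ∨
    e = (cst 0, zeroTm) ∨ e = (cst 1, oneTm)}

/-- The variety of rational Gödel algebras. -/
def RGA : AlgClass.{u} RGLang :=
  {A | blReduct A ∈ GA ∧ ∀ e ∈ bookkeeping, ∀ v : ℕ → A, e.Holds v}

/-- Rational Gödel logic, defined from rational Gödel algebras through `τ(x) = {x ≈ 1}`. -/
noncomputable def RG : PropLogic RGLang := logicOf RGA {(FirstOrder.Language.Term.var 0, oneTm)}

end RationalGodel

/-! The implication from isomorphic zero-generated subalgebras to PSC carries the content that is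
special to Gödel algebras. An underivable rule fails in some nontrivial `A` of the algebraizing
quasivariety, so the equations translating its premises are solvable in `A`. Modulo a prime filter
`P`, `A` becomes a Gödel chain, in which every operation returns one of its arguments, 0 or 1. Only
finitely many values of variables and constants matter. Since ℚ is dense, they can be order-embedded
into [0,1] ∩ ℚ with 1 and the occurring constants that differ from 1 in `A` held fixed. The images
of the variables are constants that solve the equations in every algebra where the constants
collapsed to 1 in `A` are also 1 (`GodelLaws.exists_constant_solution`). An isomorphism of
zero-generated subalgebras transfers that collapse, so the rule is active.

The other implications are general. An embedding induces an isomorphism of zero-generated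
subalgebras, so the JEP makes these isomorphic. From PSC to the JEP: the Lindenbaum algebras show
that `l` is algebraized by the quasivariety of its own rules. In that quasivariety, a finite part of
the diagram of a nontrivial `B` cannot entail 0, so by PSC it is unifiable, and the unifier maps
this part into any member `A`. Hence `B` maps homomorphically into an ultrapower of `A`
(`exists_hom_ultrapower`). By symmetry, `A` and `B` both embed into a product of ultrapowers. -/

namespace RationalGodel

open FirstOrder.Language (Term)
open FirstOrder.Language.Structure (funMap)

/-! ### Operations and identities of rational Gödel algebras -/

section Operations

variable {A : Type u} [RGLang.Structure A]

/-- The operation `∧` of an algebra in the language of rational Gödel algebras. -/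
def opInf (a b : A) : A := funMap (L := RGLang) (n := 2) (Sum.inl BLFunc.inf) ![a, b]

/-- The operation `∨`. -/
def opSup (a b : A) : A := funMap (L := RGLang) (n := 2) (Sum.inl BLFunc.sup) ![a, b]

/-- The operation `·`. -/
def opMul (a b : A) : A := funMap (L := RGLang) (n := 2) (Sum.inl BLFunc.mul) ![a, b]

/-- The operation `→`. -/
def opImp (a b : A) : A := funMap (L := RGLang) (n := 2) (Sum.inl BLFunc.imp) ![a, b]

variable (A) in
/-- The bottom element. -/
def opZero : A := funMap (L := RGLang) (n := 0) (Sum.inl BLFunc.zero) ![]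

variable (A) in
/-- The top element. -/
def opOne : A := funMap (L := RGLang) (n := 0) (Sum.inl BLFunc.one) ![]

variable (A) in
/-- The interpretation of the constant `c_q`. -/
def opCst (q : RatUnit) : A := funMap (L := RGLang) (n := 0) (Sum.inr q) ![]

variable {α : Type} (v : α → A)

@[simp] theorem realize_zeroTm : (zeroTm : RGLang.Term α).realize v = opZero A :=
  congrArg (funMap (L := RGLang) (n := 0) (Sum.inl BLFunc.zero)) (Subsingleton.elim _ _)

@[simp] theorem realize_oneTm : (oneTm : RGLang.Term α).realize v = opOne A :=
  congrArg (funMap (L := RGLang) (n := 0) (Sum.inl BLFunc.one)) (Subsingleton.elim _ _)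

@[simp] theorem realize_cst (q : RatUnit) : (cst q : RGLang.Term α).realize v = opCst A q :=
  congrArg (funMap (L := RGLang) (n := 0) (Sum.inr q)) (Subsingleton.elim _ _)

@[simp] theorem realize_mulTm (s t : RGLang.Term α) :
    (mulTm s t).realize v = opMul (s.realize v) (t.realize v) :=
  congrArg (funMap (L := RGLang) (n := 2) (Sum.inl BLFunc.mul))
    (funext fun i => by fin_cases i <;> rfl)

@[simp] theorem realize_impTm (s t : RGLang.Term α) :
    (impTm s t).realize v = opImp (s.realize v) (t.realize v) :=
  congrArg (funMap (L := RGLang) (n := 2) (Sum.inl BLFunc.imp))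
    (funext fun i => by fin_cases i <;> rfl)

end Operations

/-- A triple of elements as an assignment. -/
def tripleVal {M : Type u} (a b c : M) : ℕ → M
  | 0 => a
  | 1 => b
  | _ => c

/-- BL-terms in at most three variables, with the operation symbols as constructors. -/
inductive BLExpr : Type
  | x | y | z | zero | one
  | app (f : BLFunc 2) (s t : BLExpr)

namespace BLExpr

/-- The BL-term described by an expression. -/
def toTerm : BLExpr → BLLang.Term ℕ
  | x => Term.var 0
  | y => Term.var 1
  | z => Term.var 2
  | zero => Term.func (L := BLLang) (l := 0) BLFunc.zero ![]
  | one => Term.func (L := BLLang) (l := 0) BLFunc.one ![]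
  | app f s t => Term.func (L := BLLang) (l := 2) f ![s.toTerm, t.toTerm]

/-- The value of an expression in a BL-algebra. -/
def eval {M : Type u} [BLLang.Structure M] (a b c : M) : BLExpr → M
  | x => a
  | y => b
  | z => c
  | zero => funMap (L := BLLang) (n := 0) BLFunc.zero ![]
  | one => funMap (L := BLLang) (n := 0) BLFunc.one ![]
  | app f s t => funMap (L := BLLang) (n := 2) f ![s.eval a b c, t.eval a b c]

theorem realize_toTerm {M : Type u} [BLLang.Structure M] (v : ℕ → M) (e : BLExpr) :
    e.toTerm.realize v = e.eval (v 0) (v 1) (v 2) := by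
  induction e with
  | x | y | z => rfl
  | zero => exact congrArg (funMap (L := BLLang) (n := 0) _) (Subsingleton.elim _ _)
  | one => exact congrArg (funMap (L := BLLang) (n := 0) _) (Subsingleton.elim _ _)
  | app f s t ihs iht =>
    rw [eval, ← ihs, ← iht]
    exact congrArg (funMap (L := BLLang) (n := 2) f) (funext fun i => by fin_cases i <;> rfl)

theorem eval_eq_of_standard {A : Bundled.{u} BLLang.Structure} (hA : A ∈ GA) (s t : BLExpr)
    (h : ∀ a b c : unitInterval, s.eval a b c = t.eval a b c) (a b c : A) :
    s.eval a b c = t.eval a b c := by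
  have := hA (s.toTerm, t.toTerm) (fun v => by
    simpa only [Eqn.Holds, realize_toTerm] using h _ _ _) (tripleVal a b c)
  simp only [Eqn.Holds, realize_toTerm] at this
  exact this

end BLExpr

/-- The identities of rational Gödel algebras. -/
structure GodelLaws (A : Type u) [RGLang.Structure A] : Prop where
  mul_eq : ∀ a b : A, opMul a b = opInf a b
  imp_self : ∀ a : A, opImp a a = opOne A
  imp_one : ∀ a : A, opImp a (opOne A) = opOne A
  one_imp : ∀ a : A, opImp (opOne A) a = a
  zero_imp : ∀ a : A, opImp (opZero A) a = opOne A
  inf_one : ∀ a : A, opInf a (opOne A) = a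
  inf_zero : ∀ a : A, opInf a (opZero A) = opZero A
  inf_imp : ∀ a b : A, opInf a (opImp a b) = opInf b (opImp b a)
  imp_sup : ∀ a b : A, opInf (opSup a b) (opImp a b) = opInf b (opImp a b)
  sup_comm : ∀ a b : A, opSup a b = opSup b a
  inf_comm : ∀ a b : A, opInf a b = opInf b a
  imp_trans : ∀ a b c : A, opImp (opImp a b) (opImp (opImp b c) (opImp a c)) = opOne A
  imp_dist : ∀ a b c : A,
    opImp (opImp a (opImp b c)) (opImp (opImp a b) (opImp a c)) = opOne A
  imp_weaken : ∀ a b : A, opImp a (opImp b a) = opOne A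
  inf_le : ∀ a b : A, opImp (opInf a b) a = opOne A
  le_inf : ∀ a b : A, opImp (opImp a b) (opImp a (opInf a b)) = opOne A
  le_sup : ∀ a b : A, opImp a (opSup a b) = opOne A
  sup_le : ∀ a b : A, opImp (opImp a b) (opImp (opSup a b) b) = opOne A
  sup_elim : ∀ a b c : A,
    opImp (opImp a c) (opImp (opImp b c) (opImp (opSup a b) c)) = opOne A
  prelinear : ∀ a b : A, opSup (opImp a b) (opImp b a) = opOne A
  imp_sup_imp : ∀ a b : A, opSup (opImp a b) (opImp (opImp a b) b) = opOne A
  cst_inf : ∀ p q : RatUnit, opInf (opCst A p) (opCst A q) = opCst A (p ⊓ q)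
  cst_imp : ∀ p q : RatUnit, opImp (opCst A p) (opCst A q) = opCst A (godelImp p q)
  cst_zero : opCst A 0 = opZero A
  cst_one : opCst A 1 = opOne A

section

local infixr:60 "⇒" => BLExpr.app BLFunc.imp
local infixl:65 "⊼" => BLExpr.app BLFunc.inf
local infixl:65 "⊻" => BLExpr.app BLFunc.sup

/-- The constant-free laws are identities of [0,1], checked there by cases on the order; the last
four are the bookkeeping axioms. -/
theorem godelLaws_of_mem {A : Bundled.{u} RGLang.Structure} (hA : A ∈ RGA) : GodelLaws A := by
  have key := BLExpr.eval_eq_of_standard hA.1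
  have mul_eq : ∀ a b : A, opMul a b = opInf a b := fun a b =>
    key (.app .mul .x .y) (.x ⊼ .y) (fun _ _ _ => rfl) a b a
  have book : ∀ s t : RGLang.Term ℕ, (s, t) ∈ bookkeeping →
      s.realize (fun _ => opOne A) = t.realize (fun _ => opOne A) :=
    fun s t h => hA.2 (s, t) h _
  have le1 : ∀ x : unitInterval, x ≤ 1 := fun x => unitInterval.le_one'
  have ge0 : ∀ x : unitInterval, 0 ≤ x := fun x => unitInterval.nonneg'
  refine ⟨mul_eq,
    fun a => key (.x ⇒ .x) .one ?_ a a a,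
    fun a => key (.x ⇒ .one) .one ?_ a a a,
    fun a => key (.one ⇒ .x) .x ?_ a a a,
    fun a => key (.zero ⇒ .x) .one ?_ a a a,
    fun a => key (.x ⊼ .one) .x ?_ a a a,
    fun a => key (.x ⊼ .zero) .zero ?_ a a a,
    fun a b => key (.x ⊼ (.x ⇒ .y)) (.y ⊼ (.y ⇒ .x)) ?_ a b a,
    fun a b => key ((.x ⊻ .y) ⊼ (.x ⇒ .y)) (.y ⊼ (.x ⇒ .y)) ?_ a b a,
    fun a b => key (.x ⊻ .y) (.y ⊻ .x) ?_ a b a,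
    fun a b => key (.x ⊼ .y) (.y ⊼ .x) ?_ a b a,
    fun a b c => key ((.x ⇒ .y) ⇒ (.y ⇒ .z) ⇒ .x ⇒ .z) .one ?_ a b c,
    fun a b c => key ((.x ⇒ .y ⇒ .z) ⇒ (.x ⇒ .y) ⇒ .x ⇒ .z) .one ?_ a b c,
    fun a b => key (.x ⇒ .y ⇒ .x) .one ?_ a b a,
    fun a b => key (.x ⊼ .y ⇒ .x) .one ?_ a b a,
    fun a b => key ((.x ⇒ .y) ⇒ .x ⇒ .x ⊼ .y) .one ?_ a b a,
    fun a b => key (.x ⇒ .x ⊻ .y) .one ?_ a b a,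
    fun a b => key ((.x ⇒ .y) ⇒ .x ⊻ .y ⇒ .y) .one ?_ a b a,
    fun a b c => key ((.x ⇒ .z) ⇒ (.y ⇒ .z) ⇒ .x ⊻ .y ⇒ .z) .one ?_ a b c,
    fun a b => key ((.x ⇒ .y) ⊻ (.y ⇒ .x)) .one ?_ a b a,
    fun a b => key ((.x ⇒ .y) ⊻ ((.x ⇒ .y) ⇒ .y)) .one ?_ a b a,
    fun p q => ?_, fun p q => ?_, ?_, ?_⟩
  rotate_right 4
  · simpa [mul_eq] using book _ _ (Or.inl ⟨p, q, rfl⟩)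
  · simpa using book _ _ (Or.inr (Or.inl ⟨p, q, rfl⟩))
  · simpa using book _ _ (Or.inr (Or.inr (Or.inl rfl)))
  · simpa using book _ _ (Or.inr (Or.inr (Or.inr rfl)))
  all_goals
    intro a b c
    have ha := le1 a
    have hb := le1 b
    have hc := le1 c
    have ha' := ge0 a
    simp only [BLExpr.eval, FirstOrder.Language.Structure.funMap, godelImp, Matrix.cons_val_zero,
      Matrix.cons_val_one]
    grind

end

/-! ### Prime deductive filters -/

/-- Deductive filters: sets containing `1` and closed under modus ponens. -/
structure IsDeductive {A : Type u} [RGLang.Structure A] (P : Set A) : Prop where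
  one_mem : opOne A ∈ P
  mp : ∀ {a b : A}, a ∈ P → opImp a b ∈ P → b ∈ P

/-- A deductive filter is prime if it meets every pair with join `1`. -/
structure IsPrimeDeductive {A : Type u} [RGLang.Structure A] (P : Set A) : Prop
    extends IsDeductive P where
  prime : ∀ {a b : A}, opSup a b = opOne A → a ∈ P ∨ b ∈ P

/-- A filter maximal among those omitting `c` is prime: if `a` and `b` lie outside it, maximality
puts `a → c` and `b → c` inside, so `a ∨ b = 1` would force `c` in. -/
theorem GodelLaws.exists_prime {A : Type u} [RGLang.Structure A] (h : GodelLaws A) {c : A}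
    (hc : c ≠ opOne A) : ∃ P : Set A, IsPrimeDeductive P ∧ c ∉ P := by
  obtain ⟨P, hP⟩ := zorn_subset {P : Set A | IsDeductive P ∧ c ∉ P} (fun C hC hchain => by
    rcases C.eq_empty_or_nonempty with rfl | ⟨F, hF⟩
    · exact ⟨{opOne A}, ⟨⟨rfl, fun {a b} ha hb => by
        simp only [Set.mem_singleton_iff] at ha hb ⊢
        rwa [ha, h.one_imp] at hb⟩, hc⟩, by simp⟩
    · refine ⟨⋃₀ C, ⟨⟨⟨F, hF, (hC hF).1.one_mem⟩, ?_⟩, ?_⟩, fun s hs => Set.subset_sUnion_of_mem hs⟩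
      · rintro a b ⟨S, hS, ha⟩ ⟨T, hT, hb⟩
        rcases hchain.total hS hT with hST | hST
        · exact ⟨T, hT, (hC hT).1.mp (hST ha) hb⟩
        · exact ⟨S, hS, (hC hS).1.mp ha (hST hb)⟩
      · rintro ⟨S, hS, hcS⟩
        exact (hC hS).2 hcS)
  obtain ⟨⟨hded, hcP⟩, hmax⟩ := hP
  have key : ∀ b ∉ P, opImp b c ∈ P := fun b hb => by
    by_contra hbc
    -- By the deduction theorem, this set is the filter generated by `P` and `b`.
    refine hb (hmax (y := {x | opImp b x ∈ P}) ⟨⟨?_, ?_⟩, hbc⟩ ?_ ?_)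
    · simpa only [Set.mem_ofPred_eq, h.imp_one] using hded.one_mem
    · intro x y hx hy
      exact hded.mp hx (hded.mp hy (h.imp_dist b x y ▸ hded.one_mem))
    · intro x hx
      exact hded.mp hx (h.imp_weaken x b ▸ hded.one_mem)
    · simpa only [Set.mem_ofPred_eq, h.imp_self] using hded.one_mem
  refine ⟨P, ⟨hded, fun {a b} hab => ?_⟩, hcP⟩
  by_contra! hn
  have := hded.mp (key b hn.2) (hded.mp (key a hn.1) (h.sup_elim a b c ▸ hded.one_mem))
  rw [hab, h.one_imp] at this
  exact hcP this

namespace IsDeductive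

variable {A : Type u} [RGLang.Structure A] {P : Set A}

theorem mem_of_eq_one (hP : IsDeductive P) {a : A} (ha : a = opOne A) : a ∈ P :=
  ha ▸ hP.one_mem

theorem imp_trans (hP : IsDeductive P) (h : GodelLaws A) {a b c : A} (hab : opImp a b ∈ P)
    (hbc : opImp b c ∈ P) : opImp a c ∈ P :=
  hP.mp hbc (hP.mp hab (hP.mem_of_eq_one (h.imp_trans a b c)))

end IsDeductive

/-- The congruence of a deductive filter. -/
def FilterEquiv {A : Type u} [RGLang.Structure A] (P : Set A) (a b : A) : Prop :=
  opImp a b ∈ P ∧ opImp b a ∈ P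

namespace FilterEquiv

variable {A : Type u} [RGLang.Structure A] {P : Set A} {a a' b b' : A}

theorem rfl (h : GodelLaws A) (hP : IsDeductive P) : FilterEquiv P a a :=
  ⟨hP.mem_of_eq_one (h.imp_self a), hP.mem_of_eq_one (h.imp_self a)⟩

theorem trans (h : GodelLaws A) (hP : IsDeductive P) {c : A} (hab : FilterEquiv P a b)
    (hbc : FilterEquiv P b c) : FilterEquiv P a c :=
  ⟨hP.imp_trans h hab.1 hbc.1, hP.imp_trans h hbc.2 hab.2⟩

theorem imp_mem_iff (h : GodelLaws A) (hP : IsDeductive P) (ha : FilterEquiv P a a')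
    (hb : FilterEquiv P b b') : opImp a b ∈ P ↔ opImp a' b' ∈ P :=
  ⟨fun H => hP.imp_trans h ha.2 (hP.imp_trans h H hb.1),
    fun H => hP.imp_trans h ha.1 (hP.imp_trans h H hb.2)⟩

theorem one (h : GodelLaws A) (hP : IsDeductive P) (ha : a ∈ P) : FilterEquiv P a (opOne A) :=
  ⟨hP.mem_of_eq_one (h.imp_one a), (h.one_imp a).symm ▸ ha⟩

theorem inf_left (h : GodelLaws A) (hP : IsDeductive P) (hab : opImp a b ∈ P) :
    FilterEquiv P (opInf a b) a :=
  ⟨hP.mem_of_eq_one (h.inf_le a b), hP.mp hab (hP.mem_of_eq_one (h.le_inf a b))⟩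

theorem sup_right (h : GodelLaws A) (hP : IsDeductive P) (hab : opImp a b ∈ P) :
    FilterEquiv P (opSup a b) b :=
  ⟨hP.mp hab (hP.mem_of_eq_one (h.sup_le a b)),
    hP.mem_of_eq_one (h.sup_comm a b ▸ h.le_sup b a)⟩

/-- Primeness applied to `(a → b) ∨ ((a → b) → b) = 1`; this is the second clause of the Gödel
implication on a chain. -/
theorem imp_right (h : GodelLaws A) (hP : IsPrimeDeductive P) (hab : opImp a b ∉ P) :
    FilterEquiv P (opImp a b) b :=
  ⟨(hP.prime (h.imp_sup_imp a b)).resolve_left hab, hP.mem_of_eq_one (h.imp_weaken b a)⟩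

end FilterEquiv

/-! ### Evaluation in the algebra of constants -/

namespace GodelLaws

variable {B : Type u} [RGLang.Structure B]

theorem sup_eq (h : GodelLaws B) {a b : B} (hab : opImp a b = opOne B) : opSup a b = b := by
  simpa only [hab, h.inf_one] using h.imp_sup a b

theorem cst_sup_of_le (h : GodelLaws B) {p q : RatUnit} (hpq : p ≤ q) :
    opSup (opCst B p) (opCst B q) = opCst B q :=
  h.sup_eq (by rw [h.cst_imp, godelImp, if_pos hpq, h.cst_one])

theorem eq_of_imp (h : GodelLaws B) {a b : B} (hab : opImp a b = opOne B)
    (hba : opImp b a = opOne B) : a = b := by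
  simpa only [hab, hba, h.inf_one] using h.inf_imp a b

end GodelLaws

/-- The variables and the constants occurring in a formula. -/
def symbols : RGLang.Term ℕ → Set (ℕ ⊕ RatUnit)
  | Term.var n => {Sum.inl n}
  | Term.func (l := 0) (Sum.inr q) _ => {Sum.inr q}
  | Term.func (l := _) _ ts => ⋃ i, symbols (ts i)

theorem finite_symbols (t : RGLang.Term ℕ) : (symbols t).Finite := by
  induction t with
  | var n => exact Set.finite_singleton _
  | @func l f ts ih =>
    match l, f, ts, ih with
    | 0, Sum.inr q, ts, ih => exact Set.finite_singleton _
    | 0, Sum.inl f, ts, ih => exact Set.finite_iUnion ih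
    | n + 1, f, ts, ih => exact Set.finite_iUnion ih

section

variable {A : Type u} [RGLang.Structure A]

theorem realize_func_zero (f : RGLang.Functions 0) (ts : Fin 0 → RGLang.Term ℕ) (v : ℕ → A) :
    (Term.func f ts).realize v = funMap f ![] :=
  congrArg (funMap f) (Subsingleton.elim _ _)

theorem realize_func_two (f : RGLang.Functions 2) (ts : Fin 2 → RGLang.Term ℕ) (v : ℕ → A) :
    (Term.func f ts).realize v = funMap f ![(ts 0).realize v, (ts 1).realize v] :=
  congrArg (funMap f) (funext fun i => by fin_cases i <;> rfl)

/-- Let `g` order-embed, modulo the prime filter `P`, a set `E` of values of variables and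
constants of `A` into the rationals. Then the value of `t` is congruent to a member of `E`, whose
image under `g` is the value of the corresponding instance of `t` in `B`. -/
theorem exists_filterEquiv_and_realize_subst {B : Type u} [RGLang.Structure B] (hA : GodelLaws A)
    (hB : GodelLaws B) {P : Set A} (hP : IsPrimeDeductive P) (v : ℕ → A) (w : ℕ → B)
    (g : ℕ ⊕ RatUnit → RatUnit) (E : Set (ℕ ⊕ RatUnit))
    (h0 : Sum.inr 0 ∈ E) (h1 : Sum.inr 1 ∈ E) (hg0 : g (Sum.inr 0) = 0) (hg1 : g (Sum.inr 1) = 1)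
    (hg : ∀ i ∈ E, ∀ j ∈ E,
      opImp (Sum.elim v (opCst A) i) (Sum.elim v (opCst A) j) ∈ P ↔ g i ≤ g j)
    (t : RGLang.Term ℕ)
    (hvar : ∀ n, Sum.inl n ∈ symbols t → Sum.inl n ∈ E)
    (hcst : ∀ q, Sum.inr q ∈ symbols t →
      (Sum.inr q ∈ E ∧ g (Sum.inr q) = q) ∨ (opCst A q ∈ P ∧ opCst B q = opOne B)) :
    ∃ i ∈ E, FilterEquiv P (t.realize v) (Sum.elim v (opCst A) i) ∧
      (t.subst fun n => cst (g (Sum.inl n))).realize w = opCst B (g i) := by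
  have hded := hP.toIsDeductive
  induction t with
  | var n => exact ⟨Sum.inl n, hvar n rfl, .rfl hA hded, realize_cst _ _⟩
  | @func l f ts ih =>
    match l, f, ts, ih, hvar, hcst with
    | 0, Sum.inr q, ts, ih, hvar, hcst =>
      have e₁ : (Term.func (L := RGLang) (l := 0) (Sum.inr q) ts).realize v = opCst A q :=
        realize_func_zero ..
      have e₂ : ((Term.func (L := RGLang) (l := 0) (Sum.inr q) ts).subst
          fun n => cst (g (Sum.inl n))).realize w = opCst B q := realize_func_zero ..
      rw [e₁, e₂]
      rcases hcst q rfl with ⟨hq, hgq⟩ | ⟨hq, hBq⟩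
      · exact ⟨_, hq, .rfl hA hded, by rw [hgq]⟩
      -- A collapsed constant need not be fixed by `g`: it behaves as 1 on both sides.
      · refine ⟨_, h1, ?_, by rw [hg1, hB.cst_one, hBq]⟩
        simpa only [Sum.elim_inr, hA.cst_one] using FilterEquiv.one hA hded hq
    | 0, Sum.inl BLFunc.zero, ts, ih, hvar, hcst =>
      have e₁ : (Term.func (L := RGLang) (l := 0) (Sum.inl BLFunc.zero) ts).realize v = opZero A :=
        realize_func_zero ..
      have e₂ : ((Term.func (L := RGLang) (l := 0) (Sum.inl BLFunc.zero) ts).subst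
          fun n => cst (g (Sum.inl n))).realize w = opZero B := realize_func_zero ..
      refine ⟨_, h0, ?_, e₂.trans (by rw [hg0, hB.cst_zero])⟩
      rw [e₁, Sum.elim_inr, hA.cst_zero]
      exact .rfl hA hded
    | 0, Sum.inl BLFunc.one, ts, ih, hvar, hcst =>
      have e₁ : (Term.func (L := RGLang) (l := 0) (Sum.inl BLFunc.one) ts).realize v = opOne A :=
        realize_func_zero ..
      have e₂ : ((Term.func (L := RGLang) (l := 0) (Sum.inl BLFunc.one) ts).subst
          fun n => cst (g (Sum.inl n))).realize w = opOne B := realize_func_zero ..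
      refine ⟨_, h1, ?_, e₂.trans (by rw [hg1, hB.cst_one])⟩
      rw [e₁, Sum.elim_inr, hA.cst_one]
      exact .rfl hA hded
    | 2, Sum.inl f, ts, ih, hvar, hcst =>
      have ih' := fun k => ih k (fun n hn => hvar n (Set.mem_iUnion_of_mem k hn))
        (fun q hq => hcst q (Set.mem_iUnion_of_mem k hq))
      obtain ⟨i, hi, hi', ei⟩ := ih' 0
      obtain ⟨j, hj, hj', ej⟩ := ih' 1
      have e₁ : (Term.func (L := RGLang) (l := 2) (Sum.inl f) ts).realize v =
          funMap (L := RGLang) (n := 2) (Sum.inl f) ![(ts 0).realize v, (ts 1).realize v] :=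
        realize_func_two ..
      have e₂ : ((Term.func (L := RGLang) (l := 2) (Sum.inl f) ts).subst
          fun n => cst (g (Sum.inl n))).realize w =
          funMap (L := RGLang) (n := 2) (Sum.inl f) ![opCst B (g i), opCst B (g j)] := by
        rw [← ei, ← ej]
        exact realize_func_two ..
      rw [e₁, e₂]
      have hij := hg i hi j hj
      have hji := hg j hj i hi
      -- The order of `g i` and `g j` now decides which of `a → b` and `b → a` lie in `P`, hence
      -- which representative the compound term has.
      rw [← FilterEquiv.imp_mem_iff hA hded hi' hj'] at hij
      rw [← FilterEquiv.imp_mem_iff hA hded hj' hi'] at hji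
      generalize (ts 0).realize v = a at *
      generalize (ts 1).realize v = b at *
      have hinf : ∃ k ∈ E, FilterEquiv P (opInf a b) (Sum.elim v (opCst A) k) ∧
          opInf (opCst B (g i)) (opCst B (g j)) = opCst B (g k) := by
        rw [hB.cst_inf]
        rcases le_total (g i) (g j) with hle | hle
        · exact ⟨i, hi, (FilterEquiv.inf_left hA hded (hij.2 hle)).trans hA hded hi',
            by rw [inf_eq_left.2 hle]⟩
        · refine ⟨j, hj, ?_, by rw [inf_eq_right.2 hle]⟩
          rw [hA.inf_comm]
          exact (FilterEquiv.inf_left hA hded (hji.2 hle)).trans hA hded hj'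
      match f with
      | BLFunc.inf => exact hinf
      | BLFunc.mul =>
        change ∃ k ∈ E, FilterEquiv P (opMul a b) (Sum.elim v (opCst A) k) ∧
          opMul (opCst B (g i)) (opCst B (g j)) = opCst B (g k)
        rwa [hA.mul_eq, hB.mul_eq]
      | BLFunc.sup =>
        change ∃ k ∈ E, FilterEquiv P (opSup a b) (Sum.elim v (opCst A) k) ∧
          opSup (opCst B (g i)) (opCst B (g j)) = opCst B (g k)
        rcases le_total (g i) (g j) with hle | hle
        · exact ⟨j, hj, (FilterEquiv.sup_right hA hded (hij.2 hle)).trans hA hded hj',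
            hB.cst_sup_of_le hle⟩
        · rw [hA.sup_comm, hB.sup_comm]
          exact ⟨i, hi, (FilterEquiv.sup_right hA hded (hji.2 hle)).trans hA hded hi',
            hB.cst_sup_of_le hle⟩
      | BLFunc.imp =>
        change ∃ k ∈ E, FilterEquiv P (opImp a b) (Sum.elim v (opCst A) k) ∧
          opImp (opCst B (g i)) (opCst B (g j)) = opCst B (g k)
        rw [hB.cst_imp, godelImp]
        split_ifs with hle
        · refine ⟨_, h1, ?_, by rw [hg1]⟩
          simpa only [Sum.elim_inr, hA.cst_one] using FilterEquiv.one hA hded (hij.2 hle)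
        · exact ⟨j, hj, (FilterEquiv.imp_right hA hP (hij.not.2 hle)).trans hA hded hj', rfl⟩

end

/-! ### Extending finite order embeddings into the rationals -/

/-- Points are added one at a time, as in Cantor's back-and-forth argument: ℚ is dense without
endpoints, so any cut of a finite set can be filled. As `r` is only a total preorder, a point
equivalent to an earlier one receives the same value. -/
theorem exists_extend_embedding {ι : Type*} (r : ι → ι → Prop) (total : ∀ a b, r a b ∨ r b a)
    (trans : ∀ a b c, r a b → r b c → r a c) (I J : Finset ι) (f : ι → ℚ)
    (hf : ∀ a ∈ I, ∀ b ∈ I, r a b ↔ f a ≤ f b) :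
    ∃ g : ι → ℚ, (∀ a ∈ I, g a = f a) ∧
      ∀ a, a ∈ I ∨ a ∈ J → ∀ b, b ∈ I ∨ b ∈ J → (r a b ↔ g a ≤ g b) := by
  classical
  induction J using Finset.induction_on with
  | empty => exact ⟨f, fun _ _ => rfl, by simpa using hf⟩
  | insert x J hx ih =>
    obtain ⟨g, hgf, hg⟩ := ih
    have refl : ∀ a, r a a := fun a => (total a a).elim id id
    by_cases hxI : x ∈ I
    · refine ⟨g, hgf, fun a ha b hb => hg a ?_ b ?_⟩ <;> grind
    have hxIJ : ∀ a, a ∈ I ∨ a ∈ J → a ≠ x := by grind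
    suffices ∃ m : ℚ, ∀ a, a ∈ I ∨ a ∈ J → (r a x ↔ g a ≤ m) ∧ (r x a ↔ m ≤ g a) by
      obtain ⟨m, hm⟩ := this
      refine ⟨Function.update g x m, fun a ha => ?_, fun a ha b hb => ?_⟩
      · rw [Function.update_of_ne (hxIJ a (Or.inl ha)), hgf a ha]
      · by_cases hax : a = x <;> by_cases hbx : b = x
        · subst hax hbx; simp [refl]
        · subst hax
          rw [Function.update_self, Function.update_of_ne hbx]
          exact (hm b (by grind)).2
        · subst hbx
          rw [Function.update_self, Function.update_of_ne hax]
          exact (hm a (by grind)).1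
        · rw [Function.update_of_ne hax, Function.update_of_ne hbx]
          exact hg a (by grind) b (by grind)
    by_cases hex : ∃ y, (y ∈ I ∨ y ∈ J) ∧ r x y ∧ r y x
    · obtain ⟨y, hy, hxy, hyx⟩ := hex
      refine ⟨g y, fun a ha => ?_⟩
      rw [← hg a ha y hy, ← hg y hy a ha]
      exact ⟨⟨fun h => trans _ _ _ h hxy, fun h => trans _ _ _ h hyx⟩,
        ⟨fun h => trans _ _ _ hyx h, fun h => trans _ _ _ hxy h⟩⟩
    push Not at hex
    -- No earlier point is equivalent to `x`, so the points below and above it have strictly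
    -- separated images.
    obtain ⟨m, hlo, hhi⟩ := Order.exists_between_finsets
      (((I ∪ J).filter fun a => r a x).image g) (((I ∪ J).filter fun a => r x a).image g) (by
        simp only [Finset.mem_image, Finset.mem_filter, Finset.mem_union]
        rintro _ ⟨a, ⟨ha, hax⟩, rfl⟩ _ ⟨b, ⟨hb, hxb⟩, rfl⟩
        by_contra! hle
        exact hex b hb hxb (trans _ _ _ ((hg b hb a ha).2 hle) hax))
    simp only [Finset.mem_image, Finset.mem_filter, Finset.mem_union, forall_exists_index,
      and_imp] at hlo hhi
    refine ⟨m, fun a ha => ?_⟩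
    rcases total a x with hax | hxa
    · have := hlo _ a ha hax rfl
      exact ⟨iff_of_true hax this.le, iff_of_false (fun h => hex a ha h hax) this.not_ge⟩
    · have := hhi _ a ha hxa rfl
      exact ⟨iff_of_false (hex a ha hxa) this.not_ge, iff_of_true hxa this.le⟩

/-! ### Solving finite systems of equations by constants -/

theorem GodelLaws.zero_ne_one {A : Type u} [RGLang.Structure A] (h : GodelLaws A) [Nontrivial A] :
    opZero A ≠ opOne A := fun h01 => by
  have hz : ∀ a : A, a = opZero A := fun a => by
    rw [← h.inf_zero a, h01, h.inf_one]
  obtain ⟨a, b, hab⟩ := exists_pair_ne A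
  exact hab ((hz a).trans (hz b).symm)

/-- Finitely many equations satisfied in a nontrivial algebra `A` can be solved by constants, in all
algebras where the constants equal to `1` in `A` are equal to `1`. -/
theorem GodelLaws.exists_constant_solution {A : Type u} [RGLang.Structure A] (hA : GodelLaws A)
    [Nontrivial A] (v : ℕ → A) {T : Set (RGLang.Term ℕ)} (hT : T.Finite) :
    ∃ σ : ℕ → RatUnit, ∀ s ∈ T, ∀ t ∈ T, s.realize v = t.realize v →
      ∀ (B : Type u) [RGLang.Structure B], GodelLaws B →
        (∀ q, opCst A q = opOne A → opCst B q = opOne B) → ∀ w : ℕ → B,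
        (s.subst fun n => cst (σ n)).realize w = (t.subst fun n => cst (σ n)).realize w := by
  classical
  have hD : (⋃ t ∈ T, symbols t).Finite := hT.biUnion fun t _ => finite_symbols t
  set D : Finset (ℕ ⊕ RatUnit) := hD.toFinset
  have hmemD : ∀ t ∈ T, ∀ i ∈ symbols t, i ∈ D := fun t ht i hi =>
    hD.mem_toFinset.2 (Set.mem_biUnion ht hi)
  set S : Finset RatUnit := (insert 0 (D.preimage Sum.inr Sum.inr_injective.injOn)).filter
    fun q => opCst A q ≠ opOne A with hS
  have h0S : (0 : RatUnit) ∈ S := by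
    simp [hS, hA.cst_zero, hA.zero_ne_one]
  -- A filter omitting the largest uncollapsed constant omits all of `S`, so one prime filter
  -- suffices.
  set m := S.max' ⟨0, h0S⟩
  have hmS : m ∈ S := S.max'_mem _
  obtain ⟨P, hP, hmP⟩ := hA.exists_prime (Finset.mem_filter.1 hmS).2
  have hded := hP.toIsDeductive
  set ev : ℕ ⊕ RatUnit → A := Sum.elim v (opCst A)
  have himp : ∀ {p q : RatUnit}, p ≤ q → opImp (opCst A p) (opCst A q) ∈ P := fun {p q} h =>
    hded.mem_of_eq_one (by rw [hA.cst_imp, godelImp, if_pos h, hA.cst_one])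
  have hSP : ∀ q ∈ S, opCst A q ∉ P := fun q hq hqP =>
    hmP (hded.mp hqP (himp (S.le_max' q hq)))
  -- The prescribed part consists of 1 and the constants in `S`, and the variables are then added.
  -- The value 0 given to variables is a dummy.
  obtain ⟨g, hgf, hg⟩ := exists_extend_embedding (fun i j => opImp (ev i) (ev j) ∈ P)
    (fun a b => hP.prime (hA.prelinear _ _)) (fun a b c => hded.imp_trans hA)
    ((insert 1 S).image Sum.inr) (D.filter (·.isLeft))
    (Sum.elim (fun _ => 0) fun q : RatUnit => (q : ℚ)) (by
      simp only [Finset.mem_image]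
      rintro _ ⟨p, hp, rfl⟩ _ ⟨q, hq, rfl⟩
      refine ⟨fun h => ?_, fun h => himp h⟩
      by_contra hlt
      have hqp : q < p := not_le.1 hlt
      have hqS : q ∈ S := (Finset.mem_insert.1 hq).resolve_left fun h1 =>
        (hqp.trans_le p.2.2).ne h1
      -- For `q < p`, the element `c_p → c_q` is `c_q` itself, which lies outside `P`.
      refine hSP q hqS ?_
      simpa only [ev, Sum.elim_inr, hA.cst_imp, godelImp, if_neg hqp.not_ge] using h)
  set E : Set (ℕ ⊕ RatUnit) :=
    {a | a ∈ (insert 1 S).image Sum.inr ∨ a ∈ D.filter (·.isLeft)}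
  have hSE : ∀ q, q = 1 ∨ q ∈ S → Sum.inr q ∈ E ∧ g (Sum.inr q) = q := fun q hq => by
    have : Sum.inr q ∈ (insert 1 S).image (Sum.inr : RatUnit → ℕ ⊕ RatUnit) :=
      Finset.mem_image_of_mem _ (Finset.mem_insert.2 hq)
    exact ⟨Or.inl this, hgf _ this⟩
  obtain ⟨h0E, hg0⟩ := hSE 0 (Or.inr h0S)
  obtain ⟨h1E, hg1⟩ := hSE 1 (Or.inl rfl)
  have hbound : ∀ i ∈ E, g i ∈ Set.Icc (0 : ℚ) 1 := fun i hi => by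
    constructor
    · have := (hg _ h0E i hi).1 (hded.mem_of_eq_one (by
        simp only [ev, Sum.elim_inr, hA.cst_zero, hA.zero_imp]))
      rwa [hg0] at this
    · have := (hg i hi _ h1E).1 (hded.mem_of_eq_one (by
        simp only [ev, Sum.elim_inr, hA.cst_one, hA.imp_one]))
      rwa [hg1] at this
  -- On `E` the values already lie in [0,1], because 0 and 1 are fixed; the projection matters only
  -- off `E`.
  set g' : ℕ ⊕ RatUnit → RatUnit := fun i => Set.projIcc 0 1 zero_le_one (g i) with hg'
  have hg'E : ∀ i ∈ E, (g' i : ℚ) = g i := fun i hi => by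
    rw [hg']
    simp only [Set.projIcc_of_mem _ (hbound i hi)]
  have hgS : ∀ q, q = 1 ∨ q ∈ S → g' (Sum.inr q) = q := fun q hq =>
    Subtype.ext ((hg'E _ (hSE q hq).1).trans (hSE q hq).2)
  have hemb : ∀ i ∈ E, ∀ j ∈ E, opImp (ev i) (ev j) ∈ P ↔ g' i ≤ g' j := fun i hi j hj => by
    rw [hg i hi j hj, ← hg'E i hi, ← hg'E j hj, Subtype.coe_le_coe]
  refine ⟨fun n => g' (Sum.inl n), fun s hs t ht hst B _ hB hAB w => ?_⟩
  have main : ∀ t ∈ T, ∃ i ∈ E, FilterEquiv P (t.realize v) (ev i) ∧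
      (t.subst fun n => cst (g' (Sum.inl n))).realize w = opCst B (g' i) := fun t ht => by
    refine exists_filterEquiv_and_realize_subst hA hB hP v w g' E h0E h1E (hgS 0 (Or.inr h0S))
      (hgS 1 (Or.inl rfl)) hemb t (fun n hn => Or.inr ?_) (fun q hq => ?_)
    · exact Finset.mem_filter.2 ⟨hmemD t ht _ hn, rfl⟩
    · by_cases hq1 : opCst A q = opOne A
      · exact Or.inr ⟨hded.mem_of_eq_one hq1, hAB q hq1⟩
      · have hqS : q ∈ S := by
          simp only [hS, Finset.mem_filter, Finset.mem_insert, Finset.mem_preimage]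
          exact ⟨Or.inr (hmemD t ht _ hq), hq1⟩
        exact Or.inl ⟨(hSE q (Or.inr hqS)).1, hgS q (Or.inr hqS)⟩
  obtain ⟨i, hi, hsi, es⟩ := main s hs
  obtain ⟨j, hj, htj, et⟩ := main t ht
  rw [es, et]
  congr 1
  -- The representatives of `s` and `t` are congruent modulo `P`, so the order embedding gives them
  -- the same rational.
  have hrefl := FilterEquiv.rfl (a := s.realize v) hA hded
  rw [← hst] at htj
  exact le_antisymm
    ((hemb i hi j hj).1 ((FilterEquiv.imp_mem_iff hA hded hsi htj).1 hrefl.1))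
    ((hemb j hj i hi).1 ((FilterEquiv.imp_mem_iff hA hded htj hsi).1 hrefl.1))

/-! ### Algebraizing quasivarieties -/

theorem realize_onTerm_reduct {A : Bundled.{u} RGLang.Structure} (t : BLLang.Term ℕ) (v : ℕ → A) :
    ((BLLang.lhomWithConstants RatUnit).onTerm t).realize v = t.realize (M := blReduct A) v := by
  induction t with
  | var n => rfl
  | func f ts ih => exact congrArg (funMap (L := RGLang) (Sum.inl f)) (funext ih)

/-- An algebra satisfying all equations valid in rational Gödel algebras (in the lowest universe)
is a rational Gödel algebra. -/
theorem mem_RGA_of_valid {A : Bundled.{u} RGLang.Structure}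
    (h : ∀ s t : Fm RGLang, (∀ B ∈ RGA.{0}, ∀ v : ℕ → B, s.realize v = t.realize v) →
      ∀ v : ℕ → A, s.realize v = t.realize v) : A ∈ RGA := by
  refine ⟨fun e he v => ?_, fun e he v => h e.1 e.2 (fun B hB w => hB.2 e he w) v⟩
  have := h ((BLLang.lhomWithConstants RatUnit).onTerm e.1)
    ((BLLang.lhomWithConstants RatUnit).onTerm e.2) (fun B hB w => by
      rw [realize_onTerm_reduct, realize_onTerm_reduct]
      exact hB.1 e he w) v
  exact (realize_onTerm_reduct e.1 v).symm.trans (this.trans (realize_onTerm_reduct e.2 v))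

/-- Entailment in rational Gödel logic from a finite set of premises. -/
theorem RG_entails {Γ : Set (Fm RGLang)} (hΓ : Γ.Finite) {φ : Fm RGLang}
    (h : ∀ B ∈ RGA.{0}, ∀ v : ℕ → B, (∀ γ ∈ Γ, γ.realize v = opOne B) → φ.realize v = opOne B) :
    RG.Entails Γ φ := by
  refine ⟨Γ, subset_rfl, hΓ, ?_⟩
  rintro e ⟨e', he', rfl⟩ B hB v hv
  rw [Finset.mem_singleton] at he'
  subst he'
  have := h B hB v fun γ hγ => by
    have := hv _ (Set.mem_biUnion hγ ⟨_, Finset.mem_singleton_self _, rfl⟩)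
    simpa [Eqn.Holds, Term.realize_subst] using this
  simpa [Eqn.Holds, Term.realize_subst] using this

theorem realize_subst_const {L : FirstOrder.Language.{0, 0}} {B : Type u} [L.Structure B]
    (φ : Fm L) (t : L.Term (Fin 1)) (w : ℕ → B) :
    (t.subst fun _ => φ).realize w = t.realize fun _ => φ.realize w :=
  Term.realize_subst

theorem realize_subst_pair {L : FirstOrder.Language.{0, 0}} {B : Type u} [L.Structure B]
    (p q : Fm L) (δ : L.Term (Fin 2)) (w : ℕ → B) :
    (δ.subst ![p, q]).realize w = δ.realize ![p.realize w, q.realize w] := by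
  rw [Term.realize_subst]
  congr 1
  funext i
  fin_cases i <;> rfl

/-- Nothing is assumed about the form of `τ` and `Δ`. If `s ≈ t` is valid in `RGA`, the theorems
`Δ(s, s)` yield `Δ(s, t)` by rules of `RG`, and algebraization turns these back into `s ≈ t`. -/
theorem subset_RGA_of_algebraizedBy {l : PropLogic RGLang} (hl : l.IsExtension RG)
    {K : AlgClass.{u} RGLang} (hK : l.AlgebraizedBy K) : K ⊆ RGA := by
  obtain ⟨-, τ, Δ, hτ, hΔ, hΔ'⟩ := hK
  refine fun A hA => mem_RGA_of_valid fun s t hst v => ?_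
  have hss : ∀ δ ∈ Δ, l.Entails ∅ (δ.subst ![s, s]) := fun δ hδ => by
    rw [hτ]
    rintro e ⟨e', he', rfl⟩ B hB w -
    have := hΔ _ (Set.mem_biUnion (⟨δ, hδ, rfl⟩ : δ.subst ![Term.var 0, Term.var 1] ∈ instFms Δ _ _)
      ⟨e', he', rfl⟩) B hB (fun _ => s.realize w) (by rintro _ rfl; rfl)
    simpa only [Eqn.Holds, realize_subst_const, realize_subst_pair, Term.realize_var, if_true,
      one_ne_zero, if_false] using this
  have hstΔ : ∀ δ ∈ Δ, l.Entails ∅ (δ.subst ![s, t]) := fun δ hδ => by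
    refine l.cut (Δ := {δ.subst ![s, s]}) (by rintro _ rfl; exact hss δ hδ) (hl _ _ ?_)
    refine RG_entails (Set.finite_singleton _) fun B hB w hw => ?_
    have := hw _ rfl
    rw [realize_subst_pair] at this ⊢
    rwa [← hst B hB w]
  have := hΔ' A hA (fun n => if n = 0 then s.realize v else t.realize v) (by
    intro e he
    obtain ⟨_, ⟨δ, hδ, rfl⟩, e', he', rfl⟩ := Set.mem_iUnion₂.1 he
    have := (hτ _ _).1 (hstΔ δ hδ) _ ⟨e', he', rfl⟩ A hA v (by simp [transl])
    simpa only [Eqn.Holds, realize_subst_const, realize_subst_pair, Term.realize_var, if_true,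
      one_ne_zero, if_false] using this)
  simpa [Eqn.Holds] using this

/-! ### Zero-generated subalgebras -/

theorem HasJEP.hasIsoZeroGenerated {L : FirstOrder.Language.{0, 0}} {K : AlgClass.{u} L}
    (h : HasJEP K) : HasIsoZeroGenerated K := by
  have key : ∀ {A C : Type u} [L.Structure A] [L.Structure C], (A ↪[L] C) →
      Nonempty (zeroGenerated L A ≃[L] zeroGenerated L C) := fun {A C} _ _ f => by
    have hmap : (zeroGenerated L A).map f.toHom = zeroGenerated L C := by
      rw [zeroGenerated, FirstOrder.Language.Substructure.map_closure, Set.image_empty]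
      rfl
    rw [← hmap]
    exact ⟨f.substructureEquivMap _⟩
  intro A hA B hB hA' hB'
  obtain ⟨C, -, ⟨f⟩, ⟨g⟩⟩ := h A hA B hB hA' hB'
  obtain ⟨f'⟩ := key f
  obtain ⟨g'⟩ := key g
  exact ⟨g'.symm.comp f'⟩

theorem map_opCst {A B : Type u} [RGLang.Structure A] [RGLang.Structure B] (f : A →[RGLang] B)
    (q : RatUnit) : f (opCst A q) = opCst B q :=
  (f.map_fun _ _).trans (congrArg (funMap _) (Subsingleton.elim _ _))

theorem map_opOne {A B : Type u} [RGLang.Structure A] [RGLang.Structure B] (f : A →[RGLang] B) :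
    f (opOne A) = opOne B :=
  (f.map_fun _ _).trans (congrArg (funMap _) (Subsingleton.elim _ _))

/-- Constants are computed inside the zero-generated subalgebra, where the isomorphism preserves
them. -/
theorem opCst_eq_one_of_equiv {A B : Type u} [RGLang.Structure A] [RGLang.Structure B]
    (f : zeroGenerated RGLang A ≃[RGLang] zeroGenerated RGLang B) {q : RatUnit}
    (hq : opCst A q = opOne A) : opCst B q = opOne B := by
  set Z := zeroGenerated RGLang A
  have hq' : opCst Z q = opOne Z := Subtype.ext <|
    ((map_opCst Z.subtype.toHom q).trans hq).trans (map_opOne Z.subtype.toHom).symm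
  have := congrArg ((zeroGenerated RGLang B).subtype.toHom.comp f.toHom) hq'
  rwa [map_opCst, map_opOne] at this

theorem isPSC_of_hasIsoZeroGenerated {l : PropLogic RGLang} (hl : l.IsExtension RG)
    {K : AlgClass.{u} RGLang} (hK : l.AlgebraizedBy K) (hiso : HasIsoZeroGenerated K) :
    l.IsPSC := by
  have hsub := subset_RGA_of_algebraizedBy hl hK
  obtain ⟨-, τ, Δ, hτ, -, -⟩ := hK
  intro r hr
  by_contra hnd
  rw [PropLogic.Derivable, hτ] at hnd
  simp only [EqConsequence] at hnd
  push Not at hnd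
  obtain ⟨e, -, A, hA, v, hv, hne⟩ := hnd
  have : Nontrivial A := ⟨_, _, hne⟩
  have hfin : (⋃ γ ∈ r.premises, ⋃ e ∈ τ,
      ({e.1.subst fun _ => γ, e.2.subst fun _ => γ} : Set (Fm RGLang))).Finite :=
    r.premises.finite_toSet.biUnion fun γ _ => τ.finite_toSet.biUnion fun e _ => by simp
  obtain ⟨σ, hσ⟩ := (godelLaws_of_mem (hsub hA)).exists_constant_solution v hfin
  refine hr ⟨fun n => cst (σ n), fun γ hγ => ?_⟩
  rw [hτ]
  rintro _ ⟨e', he', rfl⟩ B hB w -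
  -- The hypothesis compares nontrivial algebras only; a trivial one satisfies every equation.
  rcases subsingleton_or_nontrivial B with hB' | hB'
  · exact Subsingleton.elim _ _
  obtain ⟨f⟩ := hiso A hA B hB inferInstance hB'
  have hmem : ∀ t : RGLang.Term (Fin 1), t = e'.1 ∨ t = e'.2 → (t.subst fun _ => γ) ∈
      ⋃ γ ∈ r.premises, ⋃ e ∈ τ,
        ({e.1.subst fun _ => γ, e.2.subst fun _ => γ} : Set (Fm RGLang)) := fun t ht =>
    Set.mem_biUnion hγ (Set.mem_biUnion he' (by rcases ht with rfl | rfl <;> simp))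
  have := hσ _ (hmem _ (Or.inl rfl)) _ (hmem _ (Or.inr rfl))
    (hv _ (Set.mem_biUnion hγ ⟨e', he', rfl⟩)) B (godelLaws_of_mem (hsub hB))
    (fun q => opCst_eq_one_of_equiv f) w
  simpa [Eqn.Holds, Term.realize_subst] using this

/-! ### The equational form of an extension of rational Gödel logic -/

/-- The formulas `s → t` and `t → s` expressing the equation `s ≈ t`. -/
def biimp (e : Eqn RGLang ℕ) : Set (Fm RGLang) := {impTm e.1 e.2, impTm e.2 e.1}

theorem finite_biimp (e : Eqn RGLang ℕ) : (biimp e).Finite := by simp [biimp]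

theorem GodelLaws.forall_biimp_iff {A : Type u} [RGLang.Structure A] (h : GodelLaws A)
    (e : Eqn RGLang ℕ) (v : ℕ → A) : (∀ χ ∈ biimp e, χ.realize v = opOne A) ↔ e.Holds v := by
  simp only [biimp, Set.mem_insert_iff, Set.mem_singleton_iff, forall_eq_or_imp, forall_eq,
    realize_impTm, Eqn.Holds]
  exact ⟨fun H => h.eq_of_imp H.1 H.2, fun H => by rw [H]; exact ⟨h.imp_self _, h.imp_self _⟩⟩

/-- The equation `e` follows from `Γ` in the logic `l`. -/
def PropLogic.EqEntails (l : PropLogic RGLang) (Γ : Set (Fm RGLang)) (e : Eqn RGLang ℕ) : Prop :=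
  ∀ χ ∈ biimp e, l.Entails Γ χ

/-- Lets `l` borrow equational reasoning in `RGA`; the congruence properties of the Lindenbaum
algebra all come from here. -/
theorem eqEntails_of_consequence {l : PropLogic RGLang} (hl : l.IsExtension RG)
    {Γ : Set (Fm RGLang)} {Θ : Set (Eqn RGLang ℕ)} (hΘ : Θ.Finite)
    (hΓ : ∀ e ∈ Θ, l.EqEntails Γ e) {e : Eqn RGLang ℕ} (h : EqConsequence RGA.{0} Θ e) :
    l.EqEntails Γ e := by
  intro χ hχ
  refine l.cut (Δ := ⋃ e ∈ Θ, biimp e) (fun ψ hψ => ?_) (hl _ _ (RG_entails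
    (hΘ.biUnion fun e _ => finite_biimp e) fun B hB v hv => ?_))
  · obtain ⟨e, he, hψ⟩ := Set.mem_iUnion₂.1 hψ
    exact hΓ e he ψ hψ
  · have hB' := godelLaws_of_mem hB
    exact (hB'.forall_biimp_iff e v).2 (h B hB v fun e' he' =>
      (hB'.forall_biimp_iff e' v).1 fun ψ hψ => hv ψ (Set.mem_biUnion he' hψ)) χ hχ

theorem entails_iff_eqEntails_one {l : PropLogic RGLang} (hl : l.IsExtension RG)
    {Γ : Set (Fm RGLang)} {φ : Fm RGLang} :
    l.Entails Γ φ ↔ l.EqEntails Γ (φ, oneTm) := by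
  constructor
  · intro h χ hχ
    refine l.cut (Δ := {φ}) (by rintro _ rfl; exact h) (hl _ _ (RG_entails
      (Set.finite_singleton _) fun B hB v hv => ?_))
    exact ((godelLaws_of_mem hB).forall_biimp_iff (φ, oneTm) v).2
      (by simpa [Eqn.Holds] using hv φ rfl) χ hχ
  · intro h
    refine l.cut h (hl _ _ (RG_entails (finite_biimp _) fun B hB v hv => ?_))
    simpa [Eqn.Holds] using ((godelLaws_of_mem hB).forall_biimp_iff (φ, oneTm) v).1 hv

/-- The quasiequations corresponding to the derivable rules of `l`. -/
def PropLogic.quasiEqns (l : PropLogic RGLang) : Set (QuasiEqn RGLang) :=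
  {q | l.EqEntails (⋃ e ∈ q.premises, biimp e) q.conclusion}

/-- The quasivariety axiomatized by the quasiequations corresponding to the rules of `l`. -/
def PropLogic.quasivariety (l : PropLogic RGLang) : AlgClass.{u} RGLang :=
  {A | ∀ q ∈ l.quasiEqns, q.Valid A}

theorem quasivariety_subset_RGA {l : PropLogic RGLang} (hl : l.IsExtension RG) :
    l.quasivariety ⊆ RGA.{u} := fun A hA => mem_RGA_of_valid fun s t hst v =>
  hA ⟨[], (s, t)⟩ (eqEntails_of_consequence hl Set.finite_empty (by simp)
    fun B hB v _ => hst B hB v) v (by simp)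

/-- Finitarity reduces the entailment to finitely many premises, and the reduced rule becomes a
quasiequation between formulas and 1. -/
theorem quasivariety_sound {l : PropLogic RGLang} (hl : l.IsExtension RG)
    {A : Bundled.{u} RGLang.Structure} (hA : A ∈ l.quasivariety) {Γ : Set (Fm RGLang)}
    {φ : Fm RGLang} (h : l.Entails Γ φ) (v : ℕ → A) (hv : ∀ γ ∈ Γ, γ.realize v = opOne A) :
    φ.realize v = opOne A := by
  obtain ⟨Δ, hΔΓ, hfin, hΔ⟩ := l.finitary h
  obtain ⟨Δ, rfl⟩ := hfin.exists_finset_coe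
  have hmem : (⟨Δ.toList.map fun γ => (γ, oneTm), (φ, oneTm)⟩ : QuasiEqn RGLang) ∈ l.quasiEqns := by
    refine (entails_iff_eqEntails_one hl).1 (l.cut (fun ψ hψ => ?_) hΔ)
    refine (entails_iff_eqEntails_one hl).2 fun χ hχ => l.of_mem (Set.mem_biUnion ?_ hχ)
    exact List.mem_map.2 ⟨ψ, Finset.mem_toList.2 hψ, rfl⟩
  have := hA _ hmem v (by
    intro e he
    obtain ⟨γ, hγ, rfl⟩ := List.mem_map.1 he
    simpa [Eqn.Holds] using hv γ (hΔΓ (Finset.mem_toList.1 hγ)))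
  simpa [Eqn.Holds] using this

/-! ### Lindenbaum algebras -/

/-- Equality modulo `Γ` in an extension of rational Gödel logic. -/
def lindenbaumSetoid {l : PropLogic RGLang} (hl : l.IsExtension RG) (Γ : Set (Fm RGLang)) :
    Setoid (Fm RGLang) where
  r s t := l.EqEntails Γ (s, t)
  iseqv :=
    { refl := fun s => eqEntails_of_consequence hl Set.finite_empty (by simp)
        fun B _ v _ => rfl
      symm := fun {s t} h => eqEntails_of_consequence hl (Set.finite_singleton (s, t))
        (by rintro _ rfl; exact h) fun B _ v hv => (hv (s, t) rfl).symm
      trans := fun {s t r} h h' => eqEntails_of_consequence hl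
        (Set.toFinite {(s, t), (t, r)}) (by rintro _ (rfl | rfl) <;> assumption)
        fun B _ v hv => (hv (s, t) (by simp)).trans (hv (t, r) (by simp)) }

/-- The algebra of formulas, with equality modulo `Γ` as a congruence. -/
instance lindenbaumPrestructure {l : PropLogic RGLang} (hl : l.IsExtension RG)
    (Γ : Set (Fm RGLang)) : RGLang.Prestructure (lindenbaumSetoid hl Γ) where
  toStructure := { funMap := fun f ts => Term.func f ts, RelMap := fun _ _ => False }
  fun_equiv {n f} x y hxy := eqEntails_of_consequence hl
    (Set.finite_range fun i => (x i, y i)) (by rintro _ ⟨i, rfl⟩; exact hxy i)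
    fun B _ v hv => congrArg (funMap f) (funext fun i => hv (x i, y i) ⟨i, rfl⟩)
  rel_equiv _ _ _ := rfl

/-- The Lindenbaum algebra of `Γ`. -/
abbrev Lindenbaum {l : PropLogic RGLang} (hl : l.IsExtension RG) (Γ : Set (Fm RGLang)) : Type :=
  Quotient (lindenbaumSetoid hl Γ)

theorem realize_lindenbaum {l : PropLogic RGLang} (hl : l.IsExtension RG) (Γ : Set (Fm RGLang))
    (t : Fm RGLang) (σ : ℕ → Fm RGLang) :
    (t.realize fun n => (⟦σ n⟧ : Lindenbaum hl Γ)) = ⟦t.subst σ⟧ := by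
  rw [Term.realize_quotient_mk']
  congr 1
  induction t with
  | var n => rfl
  | func f ts ih => exact congrArg (Term.func f) (funext ih)

theorem impTm_subst (s t : Fm RGLang) (σ : ℕ → Fm RGLang) :
    (impTm s t).subst σ = impTm (s.subst σ) (t.subst σ) :=
  congrArg (Term.func (L := RGLang) (l := 2) (Sum.inl BLFunc.imp))
    (funext fun i => by fin_cases i <;> rfl)

theorem biimp_subst (e : Eqn RGLang ℕ) (σ : ℕ → Fm RGLang) :
    (fun γ : Fm RGLang => γ.subst σ) '' biimp e = biimp (e.1.subst σ, e.2.subst σ) := by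
  simp [biimp, Set.image_pair, impTm_subst]

/-- An assignment into the quotient is a substitution, so validity amounts to substitution
invariance followed by cut. -/
theorem lindenbaum_valid {l : PropLogic RGLang} (hl : l.IsExtension RG) (Γ : Set (Fm RGLang))
    {q : QuasiEqn RGLang} (hq : q ∈ l.quasiEqns) : q.Valid (Lindenbaum hl Γ) := by
  intro v hv
  obtain ⟨σ, rfl⟩ : ∃ σ : ℕ → Fm RGLang, v = fun n => ⟦σ n⟧ :=
    ⟨fun n => (v n).out, funext fun n => (Quotient.out_eq _).symm⟩
  have hiff : ∀ e : Eqn RGLang ℕ, e.Holds (fun n => (⟦σ n⟧ : Lindenbaum hl Γ)) ↔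
      l.EqEntails Γ (e.1.subst σ, e.2.subst σ) := fun e => by
    rw [Eqn.Holds, realize_lindenbaum, realize_lindenbaum]
    exact Quotient.eq
  rw [hiff]
  intro χ hχ
  rw [← biimp_subst] at hχ
  obtain ⟨χ, hχ, rfl⟩ := hχ
  refine l.cut (fun ψ hψ => ?_) (l.subst σ (hq χ hχ))
  obtain ⟨ψ, hψ, rfl⟩ := hψ
  obtain ⟨e, he, hψ⟩ := Set.mem_iUnion₂.1 hψ
  exact (hiff e).1 (hv e he) _ (biimp_subst e σ ▸ Set.mem_image_of_mem _ hψ)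

/-- Quasiequations are inherited along jointly injective pairs of homomorphisms. -/
theorem QuasiEqn.Valid.of_jointly_injective {L : FirstOrder.Language.{0, 0}} {q : QuasiEqn L}
    {A B C : Type*} [L.Structure A] [L.Structure B] [L.Structure C] (f : C →[L] A) (g : C →[L] B)
    (hfg : ∀ x y, f x = f y → g x = g y → x = y) (hA : q.Valid A) (hB : q.Valid B) :
    q.Valid C := by
  intro v hv
  refine hfg _ _ ?_ ?_
  · rw [← FirstOrder.Language.HomClass.realize_term, ← FirstOrder.Language.HomClass.realize_term]
    refine hA _ fun e he => ?_
    simpa only [Eqn.Holds, FirstOrder.Language.HomClass.realize_term] using congrArg f (hv e he)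
  · rw [← FirstOrder.Language.HomClass.realize_term, ← FirstOrder.Language.HomClass.realize_term]
    refine hB _ fun e he => ?_
    simpa only [Eqn.Holds, FirstOrder.Language.HomClass.realize_term] using congrArg g (hv e he)

theorem oneTm_subst {α : Type} (σ : α → Fm RGLang) : (oneTm : RGLang.Term α).subst σ = oneTm :=
  congrArg (Term.func (L := RGLang) (l := 0) (Sum.inl BLFunc.one)) (Subsingleton.elim _ _)

/-- Under the canonical assignment, the formulas with value 1 in the Lindenbaum algebra of `Γ` are
exactly the consequences of `Γ`. `ULift` only moves this algebra to the required universe. -/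
theorem quasivariety_complete {l : PropLogic RGLang} (hl : l.IsExtension RG) {Γ : Set (Fm RGLang)}
    {φ : Fm RGLang} (h : ∀ A ∈ l.quasivariety.{u}, ∀ v : ℕ → A,
      (∀ γ ∈ Γ, γ.realize v = opOne A) → φ.realize v = opOne A) : l.Entails Γ φ := by
  let e : Lindenbaum hl Γ ≃ ULift.{u} (Lindenbaum hl Γ) := Equiv.ulift.symm
  let _ : RGLang.Structure (ULift.{u} (Lindenbaum hl Γ)) := e.inducedStructure
  let f : Lindenbaum hl Γ ≃[RGLang] ULift.{u} (Lindenbaum hl Γ) := e.inducedStructureEquiv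
  have hiff : ∀ γ : Fm RGLang, γ.realize (f ∘ fun n => (⟦Term.var n⟧ : Lindenbaum hl Γ)) =
      opOne (ULift.{u} (Lindenbaum hl Γ)) ↔ l.Entails Γ γ := fun γ => by
    rw [entails_iff_eqEntails_one hl,
      ← realize_oneTm (f ∘ fun n => (⟦Term.var n⟧ : Lindenbaum hl Γ)),
      FirstOrder.Language.HomClass.realize_term, FirstOrder.Language.HomClass.realize_term,
      f.injective.eq_iff, realize_lindenbaum, realize_lindenbaum, oneTm_subst]
    have : γ.subst Term.var = γ := by
      induction γ with
      | var n => rfl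
      | func g ts ih => exact congrArg (Term.func g) (funext ih)
    rw [this]
    exact Quotient.eq
  refine (hiff φ).1 (h ⟨ULift.{u} (Lindenbaum hl Γ), inferInstance⟩ (fun q hq => ?_) _
    fun γ hγ => (hiff γ).2 (l.of_mem hγ))
  exact .of_jointly_injective f.symm.toHom f.symm.toHom (fun x y hxy _ => f.symm.injective hxy)
    (lindenbaum_valid hl Γ hq) (lindenbaum_valid hl Γ hq)

theorem algebraizedBy_quasivariety {l : PropLogic RGLang} (hl : l.IsExtension RG) :
    l.AlgebraizedBy l.quasivariety.{u} := by
  classical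
  have hlaws : ∀ A ∈ l.quasivariety.{u}, GodelLaws A :=
    fun A hA => godelLaws_of_mem (quasivariety_subset_RGA hl hA)
  refine ⟨⟨l.quasiEqns, fun A => Iff.rfl⟩, {(Term.var 0, oneTm)},
    {impTm (Term.var 0) (Term.var 1), impTm (Term.var 1) (Term.var 0)}, fun Γ φ => ?_, ?_, ?_⟩
  · have hholds : ∀ (A : Bundled.{u} RGLang.Structure) (v : ℕ → A),
        (∀ e ∈ transl {(Term.var 0, oneTm)} Γ, e.Holds v) ↔ ∀ γ ∈ Γ, γ.realize v = opOne A := by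
      intro A v
      constructor
      · intro h γ hγ
        simpa [Eqn.Holds] using
          h _ (Set.mem_biUnion hγ ⟨_, Finset.mem_singleton_self _, rfl⟩)
      · intro h e he
        obtain ⟨γ, hγ, e', he', rfl⟩ := Set.mem_iUnion₂.1 he
        rw [Finset.mem_singleton.1 he']
        simpa [Eqn.Holds] using h γ hγ
    constructor
    · rintro h e ⟨e', he', rfl⟩ A hA v hv
      rw [Finset.mem_singleton.1 he']
      simpa [Eqn.Holds] using quasivariety_sound hl hA h v ((hholds A v).1 hv)
    · intro h
      refine quasivariety_complete hl fun A hA v hv => ?_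
      simpa [Eqn.Holds] using h _ ⟨_, Finset.mem_singleton_self _, rfl⟩ A hA v ((hholds A v).2 hv)
  · intro e he A hA v hv
    obtain ⟨_, ⟨δ, hδ, rfl⟩, e', he', rfl⟩ := Set.mem_iUnion₂.1 he
    have h01 : v 0 = v 1 := hv _ rfl
    rw [Finset.mem_singleton.1 he']
    simp only [Finset.mem_insert, Finset.mem_singleton] at hδ
    rcases hδ with rfl | rfl <;> simp [Eqn.Holds, h01, (hlaws A hA).imp_self]
  · intro A hA v hv
    have key : ∀ δ : RGLang.Term (Fin 2), δ = impTm (Term.var 0) (Term.var 1) ∨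
        δ = impTm (Term.var 1) (Term.var 0) → δ.realize ![v 0, v 1] = opOne A := fun δ hδ => by
      have := hv _ (Set.mem_biUnion ⟨δ, by simpa using hδ, rfl⟩
        ⟨_, Finset.mem_singleton_self _, rfl⟩)
      simpa only [Eqn.Holds, realize_subst_const, realize_subst_pair, Term.realize_var,
        realize_oneTm] using this
    have h₁ := key _ (Or.inl rfl)
    have h₂ := key _ (Or.inr rfl)
    rw [realize_impTm] at h₁ h₂
    exact (hlaws A hA).eq_of_imp h₁ h₂

/-! ### Joint embeddings -/

theorem isEmpty_relations (n : ℕ) : IsEmpty (RGLang.Relations n) :=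
  ⟨fun r => r.elim (fun r => nomatch (r : Empty)) fun r => nomatch (r : Empty)⟩

/-- An operation-preserving map is a homomorphism. -/
def homOfMapFun {A B : Type*} [RGLang.Structure A] [RGLang.Structure B] (f : A → B)
    (hf : ∀ {n : ℕ} (F : RGLang.Functions n) (x : Fin n → A), f (funMap F x) = funMap F (f ∘ x)) :
    A →[RGLang] B where
  toFun := f
  map_fun' := hf
  map_rel' r := (isEmpty_relations _).elim r

/-- An injective homomorphism is an embedding. -/
def embeddingOfHom {A B : Type*} [RGLang.Structure A] [RGLang.Structure B] (f : A →[RGLang] B)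
    (hf : Function.Injective f) : A ↪[RGLang] B where
  toFun := f
  inj' := hf
  map_fun' := f.map_fun
  map_rel' r := (isEmpty_relations _).elim r

/-- The direct product of two algebras. -/
instance prodStructure {L : FirstOrder.Language.{0, 0}} (A B : Type u) [L.Structure A]
    [L.Structure B] : L.Structure (A × B) where
  funMap F x := (funMap F fun i => (x i).1, funMap F fun i => (x i).2)
  RelMap r x := (FirstOrder.Language.Structure.RelMap r fun i => (x i).1) ∧
    FirstOrder.Language.Structure.RelMap r fun i => (x i).2

theorem prod_mem_quasivariety {l : PropLogic RGLang} {A B : Type u} [RGLang.Structure A]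
    [RGLang.Structure B] (hA : ⟨A, inferInstance⟩ ∈ l.quasivariety)
    (hB : ⟨B, inferInstance⟩ ∈ l.quasivariety) :
    (⟨A × B, inferInstance⟩ : Bundled RGLang.Structure) ∈ l.quasivariety := fun q hq =>
  .of_jointly_injective (homOfMapFun Prod.fst fun _ _ => rfl) (homOfMapFun Prod.snd fun _ _ => rfl)
    (fun _ _ h₁ h₂ => Prod.ext h₁ h₂) (hA q hq) (hB q hq)

/-- Validity of quasiequations is preserved by ultrapowers. -/
theorem QuasiEqn.Valid.ultrapower {L : FirstOrder.Language.{0, 0}} {q : QuasiEqn L} {A ι : Type u}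
    [L.Structure A] (h : q.Valid A) (U : Ultrafilter ι) :
    q.Valid ((U : Filter ι).Product fun _ => A) := by
  intro v hv
  obtain ⟨x, rfl⟩ : ∃ x : ℕ → ι → A, v = fun n => (x n : (U : Filter ι).Product fun _ => A) :=
    ⟨fun n => (v n).out, funext fun n => (Quotient.out_eq _).symm⟩
  have hiff : ∀ e : Eqn L ℕ, e.Holds (fun n => (x n : (U : Filter ι).Product fun _ => A)) ↔
      ∀ᶠ i in (U : Filter ι), e.Holds fun n => x n i := fun e => by
    rw [Eqn.Holds, FirstOrder.Language.Ultraproduct.term_realize_cast,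
      FirstOrder.Language.Ultraproduct.term_realize_cast]
    exact Quotient.eq
  refine (hiff _).2 ?_
  have : ∀ᶠ i in (U : Filter ι), ∀ e ∈ q.premises, e.Holds fun n => x n i :=
    (Filter.eventually_all_finite q.premises.finite_toSet).2 fun e he => (hiff e).1 (hv e he)
  exact this.mono fun i hi => h _ hi

/-- The diagonal homomorphism into an ultrapower. -/
theorem exists_injective_hom_ultrapower (A : Type u) {ι : Type u} [RGLang.Structure A]
    (U : Ultrafilter ι) :
    ∃ f : A →[RGLang] ((U : Filter ι).Product fun _ => A), Function.Injective f := by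
  refine ⟨homOfMapFun (fun a => ((fun _ => a : ι → A) : (U : Filter ι).Product fun _ => A))
    fun F x => ?_, fun a b hab => ?_⟩
  · exact (FirstOrder.Language.Ultraproduct.funMap_cast F fun i _ => x i).symm
  · have : ∀ᶠ _ in (U : Filter ι), a = b := Quotient.exact hab
    exact this.exists.choose_spec

/-- An algebra whose finite parts map into `A` has a homomorphism into an ultrapower of `A`. -/
theorem exists_hom_ultrapower {A B : Type u} [RGLang.Structure A] [RGLang.Structure B]
    (h : ∀ F : Finset (Σ n, RGLang.Functions n × (Fin n → B)),
      ∃ g : B → A, ∀ x ∈ F, g (funMap x.2.1 x.2.2) = funMap x.2.1 (g ∘ x.2.2)) :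
    ∃ (ι : Type u) (U : Ultrafilter ι),
      Nonempty (B →[RGLang] ((U : Filter ι).Product fun _ => A)) := by
  classical
  choose G hG using h
  -- The index set consists of the finite parts of the operation tables of `B`. Each entry belongs
  -- to all sufficiently large parts, so the local maps jointly preserve it modulo the ultrafilter.
  refine ⟨Finset (Σ n, RGLang.Functions n × (Fin n → B)), Ultrafilter.of Filter.atTop,
    ⟨homOfMapFun (fun b => ((fun F => G F b) : Filter.Product _ fun _ => A)) fun {n} f x => ?_⟩⟩
  refine Eq.trans (Quotient.sound ?_)
    (FirstOrder.Language.Ultraproduct.funMap_cast f fun i F => G F (x i)).symm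
  have : ∀ᶠ F : Finset (Σ n, RGLang.Functions n × (Fin n → B)) in Filter.atTop,
      {⟨n, f, x⟩} ≤ F := Filter.eventually_ge_atTop _
  exact Filter.Eventually.mono (Ultrafilter.of_le _ this) fun F hF =>
    hG F ⟨n, f, x⟩ (Finset.singleton_subset_iff.1 hF)

/-- In the quasivariety of a passively structurally complete logic, finite parts of nontrivial
algebras map into all algebras. -/
theorem PropLogic.IsPSC.exists_local_hom {l : PropLogic RGLang} (hl : l.IsExtension RG)
    (hpsc : l.IsPSC) {A B : Bundled.{u} RGLang.Structure} (hA : A ∈ l.quasivariety)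
    (hB : B ∈ l.quasivariety) [Nontrivial B]
    (F : Finset (Σ n, RGLang.Functions n × (Fin n → B))) :
    ∃ g : B → A, ∀ x ∈ F, g (funMap x.2.1 x.2.2) = funMap x.2.1 (g ∘ x.2.2) := by
  have hA' := godelLaws_of_mem (quasivariety_subset_RGA hl hA)
  have hB' := godelLaws_of_mem (quasivariety_subset_RGA hl hB)
  have hT : (⋃ x ∈ F, insert (funMap x.2.1 x.2.2) (Set.range x.2.2)).Finite :=
    F.finite_toSet.biUnion fun x _ => (Set.finite_range _).insert _
  -- `ν` names the finitely many relevant elements of `B` by distinct variables.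
  obtain ⟨ν, hν⟩ := Set.countable_iff_exists_injOn.1 hT.countable
  set T := ⋃ x ∈ F, insert (funMap x.2.1 x.2.2) (Set.range x.2.2)
  set vB : ℕ → B := Function.invFunOn ν T
  have hvB : ∀ b ∈ T, vB (ν b) = b := fun b hb => hν.leftInvOn_invFunOn hb
  let eqn (x : Σ n, RGLang.Functions n × (Fin n → B)) : Eqn RGLang ℕ :=
    (Term.func x.2.1 fun i => Term.var (ν (x.2.2 i)), Term.var (ν (funMap x.2.1 x.2.2)))
  have hΓ : (⋃ x ∈ F, biimp (eqn x)).Finite := F.finite_toSet.biUnion fun x _ => finite_biimp _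
  -- The rule from the finite diagram to 0 fails in the nontrivial `B`, so it cannot be passive.
  have hact : l.Active ⟨hΓ.toFinset, zeroTm⟩ := by
    by_contra hpas
    have hder : l.Entails (hΓ.toFinset : Set (Fm RGLang)) zeroTm := hpsc _ hpas
    rw [hΓ.coe_toFinset] at hder
    have := quasivariety_sound hl hB hder vB fun γ hγ => by
      obtain ⟨x, hx, hγ⟩ := Set.mem_iUnion₂.1 hγ
      refine (hB'.forall_biimp_iff (eqn x) vB).2 ?_ γ hγ
      have hval : ∀ i, vB (ν (x.2.2 i)) = x.2.2 i := fun i =>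
        hvB _ (Set.mem_biUnion hx (Set.mem_insert_of_mem _ ⟨i, rfl⟩))
      simp only [Eqn.Holds, eqn, Term.realize_func, Term.realize_var, hval]
      exact (hvB _ (Set.mem_biUnion hx (Set.mem_insert _ _))).symm
    rw [realize_zeroTm] at this
    exact hB'.zero_ne_one this
  obtain ⟨σ, hσ⟩ := hact
  -- Any assignment would do, since the substituted premises are theorems.
  let w : ℕ → A := fun n => (σ n).realize fun _ => opOne A
  refine ⟨fun b => w (ν b), fun x hx => ?_⟩
  have : (eqn x).Holds w := (hA'.forall_biimp_iff _ w).1 fun χ hχ => by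
    have := quasivariety_sound hl hA (hσ χ (hΓ.mem_toFinset.2 (Set.mem_biUnion hx hχ)))
      (fun _ => opOne A) (by simp)
    rwa [Term.realize_subst] at this
  exact this.symm

/-- The homomorphisms into ultrapowers need not be injective; pairing each with a diagonal map makes
it an embedding into the product. -/
theorem PropLogic.IsPSC.hasJEP {l : PropLogic RGLang} (hl : l.IsExtension RG) (hpsc : l.IsPSC) :
    HasJEP l.quasivariety.{u} := by
  intro A hA B hB hA' hB'
  obtain ⟨ι, U, ⟨f⟩⟩ := exists_hom_ultrapower (hpsc.exists_local_hom hl hA hB)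
  obtain ⟨κ, V, ⟨g⟩⟩ := exists_hom_ultrapower (hpsc.exists_local_hom hl hB hA)
  obtain ⟨i, hi⟩ := exists_injective_hom_ultrapower A U
  obtain ⟨j, hj⟩ := exists_injective_hom_ultrapower B V
  refine ⟨_, prod_mem_quasivariety (A := (U : Filter ι).Product fun _ => A)
    (B := (V : Filter κ).Product fun _ => B) (fun q hq => (hA q hq).ultrapower U)
    (fun q hq => (hB q hq).ultrapower V), ⟨embeddingOfHom (homOfMapFun (fun a => (i a, g a))
      fun F x => Prod.ext (i.map_fun F x) (g.map_fun F x)) fun a b h => hi ?_⟩,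
    ⟨embeddingOfHom (homOfMapFun (fun b => (f b, j b))
      fun F x => Prod.ext (f.map_fun F x) (j.map_fun F x)) fun a b h => hj ?_⟩⟩
  · exact (Prod.ext_iff.1 h).1
  · exact (Prod.ext_iff.1 h).2

end RationalGodel

theorem theorem8p1 (l : RationalGodel.PropLogic RationalGodel.RGLang)
    (hl : l.IsExtension RationalGodel.RG) :
    List.TFAE
      [l.IsPSC,
        ∃ K : RationalGodel.AlgClass.{u} RationalGodel.RGLang,
          l.AlgebraizedBy K ∧ RationalGodel.HasJEP K,
        ∃ K : RationalGodel.AlgClass.{u} RationalGodel.RGLang,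
          l.AlgebraizedBy K ∧ RationalGodel.HasIsoZeroGenerated K] := by
  tfae_have 1 → 2 := fun h =>
    ⟨l.quasivariety, RationalGodel.algebraizedBy_quasivariety hl, h.hasJEP hl⟩
  tfae_have 2 → 3 := fun ⟨K, hK, hJEP⟩ => ⟨K, hK, hJEP.hasIsoZeroGenerated⟩
  tfae_have 3 → 1 := fun ⟨_, hK, hiso⟩ => RationalGodel.isPSC_of_hasIsoZeroGenerated hl hK hiso
  tfae_finish
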